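/- Let $X$ be a real or complex Banach space, and let $(x_n)$ and $(y_n)$ be two seminormalized (that is, $0<\inf_n\|x_n\|\le\sup_n\|x_n\|<\infty$, and likewise for $(y_n)$) weakly null basic sequences in $X$. Suppose that they have spreading models $E$ and $F$ with bases $(\tilde x_n)$ and $(\tilde y_n)$, respectively. Here a Banach space $E$ with a sequence $(\tilde x_n)$ whose closed linear span is $E$ is called the spreading model of $(x_n)$ if $$\Big\|\sum_{i=1}^k a_i\tilde x_i\Big\|_E=\lim_{\substack{n_1\to\infty\\ n_1<n_2<\cdots<n_k}}\Big\|\sum_{i=1}^k a_i x_{n_i}\Big\|$$ for all $k\in\mathbb N$ and all scalars $a_1,\dots,a_k$. Let $f(t)=\log_2(t+1)$ for $t\ge 1$. For $r>0$ and a finitely supported scalar sequence $a=(a_i)\in c_{00}$ put $$\|a\|_{f^r}=\max_{l\ge 1,\ n_1<\cdots<n_l}\frac1{f(l)^r}\sum_{i=1}^l|a_{n_i}|,\qquad |||a|||_{f^r}=\sum_{i=1}^\infty\frac{a^\#_i}{f(i)^r},$$ where $(a^\#_i)$ is the decreasing rearrangement of $(|a_i|)$. Assume that for some $0<p<q$ and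 some $0<c,C<\infty$, $$\Big\|\sum_i a_i\tilde x_i\Big\|_E\ge c\,\|a\|_{f^p}\quad\text{and}\quad \Big\|\sum_i a_i\tilde y_i\Big\|_F\le C\,|||a|||_{f^q}\qquad\text{for all } a=(a_i)\in c_{00}.$$ Then there is a subsequence $(n_k)$ of $\mathbb N$ such that the map $x_{n_k}\mapsto y_{n_k}$ extends to a bounded linear operator from the closed linear span of $(x_{n_k})$ to the closed linear span of $(y_{n_k})$. -/

import Mathlib

open Filter Topology

noncomputable section

/-- The closed linear span `[v i : i]` of a family of vectors. -/
def closedSpan (𝕜 : Type*) {ι X : Type*} [RCLike 𝕜] [NormedAddCommGroup X] [NormedSpace 𝕜 X]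
    (v : ι → X) : Submodule 𝕜 X :=
  (Submodule.span 𝕜 (Set.range v)).topologicalClosure

theorem mem_closedSpan (𝕜 : Type*) {ι X : Type*} [RCLike 𝕜] [NormedAddCommGroup X]
    [NormedSpace 𝕜 X] (v : ι → X) (i : ι) : v i ∈ closedSpan 𝕜 v :=
  Submodule.le_topologicalClosure _ (Submodule.subset_span (Set.mem_range_self i))

/-- A basic sequence: a sequence that is a Schauder basis of its closed linear span. -/
def IsBasicSequence (𝕜 : Type*) {X : Type*} [RCLike 𝕜] [NormedAddCommGroup X] [NormedSpace 𝕜 X]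
    (x : ℕ → X) : Prop :=
  ∃ b : SchauderBasis 𝕜 (closedSpan 𝕜 x), ∀ n, ((b n : closedSpan 𝕜 x) : X) = x n

/-- Seminormalized: the norms are bounded above, and bounded away from zero. -/
def IsSeminormalized {X : Type*} [NormedAddCommGroup X] (x : ℕ → X) : Prop :=
  ∃ m M : ℝ, 0 < m ∧ ∀ n, m ≤ ‖x n‖ ∧ ‖x n‖ ≤ M

/-- Weakly null: every continuous linear functional tends to zero along the sequence. -/
def IsWeaklyNull (𝕜 : Type*) {X : Type*} [RCLike 𝕜] [NormedAddCommGroup X] [NormedSpace 𝕜 X]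
    (x : ℕ → X) : Prop :=
  ∀ φ : StrongDual 𝕜 X, Tendsto (fun n => φ (x n)) atTop (𝓝 0)

/-- The normed space `E`, with the distinguished sequence `e`, is the spreading model of `x`: the
vectors `e i` span a dense subspace of `E`, and for all scalars `a 0, …, a (k - 1)`,
`‖∑ i, a i • e i‖` is the limit of `‖∑ i, a i • x (n i)‖` as
`n 0 < n 1 < ⋯ < n (k - 1)` and `n 0 → ∞`. -/
def IsSpreadingModel (𝕜 : Type*) {X E : Type*} [RCLike 𝕜]
    [NormedAddCommGroup X] [NormedSpace 𝕜 X] [NormedAddCommGroup E] [NormedSpace 𝕜 E]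
    (x : ℕ → X) (e : ℕ → E) : Prop :=
  closedSpan 𝕜 e = ⊤ ∧
    ∀ (k : ℕ) (a : Fin k → 𝕜) (ε : ℝ), 0 < ε →
      ∃ N : ℕ, ∀ n : Fin k → ℕ, StrictMono n → (∀ i, N ≤ n i) →
        |‖∑ i, a i • x (n i)‖ - ‖∑ i, a i • e i‖| < ε

/-- The norm `‖a‖_g = max (1 / g l) * (|a_{n_1}| + ⋯ + |a_{n_l}|)` on finitely supported
sequences, the maximum being over all `l ≥ 1` and all `n_1 < ⋯ < n_l`, that is, over all
nonempty finite sets of indices. -/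
def gNorm {𝕜 : Type*} [RCLike 𝕜] (g : ℝ → ℝ) (a : ℕ →₀ 𝕜) : ℝ :=
  ⨆ s : {s : Finset ℕ // s.Nonempty}, (1 / g (s.1.card : ℝ)) * ∑ i ∈ s.1, ‖a i‖

/-- The decreasing rearrangement of the sequence of absolute values of a finitely supported
sequence, indexed from `0`: the absolute values of the nonzero coordinates are listed, with
multiplicity, in decreasing order, and are followed by zeros. -/
def decrRearr {𝕜 : Type*} [RCLike 𝕜] (a : ℕ →₀ 𝕜) (i : ℕ) : ℝ :=
  ((a.support.val.map fun j => ‖a j‖).sort (· ≥ ·)).getD i 0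

/-- The norm `|||a|||_g = ∑_{i ≥ 1} a^#_i / g i` on finitely supported sequences, where `a^#` is
the decreasing rearrangement of `|a|`; the terms with `i > card (support a)` are zero. -/
def gLorentzNorm {𝕜 : Type*} [RCLike 𝕜] (g : ℝ → ℝ) (a : ℕ →₀ 𝕜) : ℝ :=
  ∑ i ∈ Finset.range a.support.card, (1 / g ((i : ℝ) + 1)) * decrRearr a i

/-- The function `f ^ p`, where `f t = log₂ (t + 1)`. -/
def fPow (p : ℝ) (t : ℝ) : ℝ := (Real.logb 2 (t + 1)) ^ p

end

/-! Write `v = ∑ aᵢ x_{m i}` for finitely supported `a`. It suffices to find a subsequence `m` and a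
constant with `‖∑ aᵢ y_{m i}‖ ≤ const · ‖v‖`; density does the rest.

The spreading model of `x` controls only vectors supported on a few late indices, while `a` is
arbitrary and `x` need not be unconditional. So each finite set `F` that starts late enough gets a
functional `Φ F`, equal to `1` on the `x i` with `i ∈ F` and of norm at most `(2/c) f(|F|)^p`.
Iterated weak* limits and weak nullness give a subsequence along which `Φ F` almost vanishes at the
other late terms (`exists_subsequence_small_off_support`). Applying `Φ S` to a tail of `v`, for all
`S ⊆ F`, yields `∑_{i ∈ F} |aᵢ| ≤ K ‖v‖ f(|F|)^p` whenever `min F ≥ k` and `|F| ≤ H k`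
(`exists_subsequence_sum_norm_le`).

Scale `a` so that `|aᵢ| ≤ 1/4`, and sort the coordinates into levels `4^(-2^(k+1)) < |aᵢ| ≤
4^(-2^k)`. On level `k` the indices below `k` contribute little. The others number at most `H k`:
otherwise `H k` of them would have a sum linear in `H k`, against a bound of logarithmic-power size.
Hence that piece is governed by the spreading model of `y`. Since `q > p`, its `f^q`-Lorentz norm
decays geometrically in `k` (`sum_div_fPow_le_levelBound`), and the levels can be summed
(`norm_sum_smul_le_of_levels`). -/

noncomputable section

/-! ### Extending functionals and operators; coordinate bounds for basic sequences -/

section Extension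

variable {𝕜 X : Type*} [RCLike 𝕜] [NormedAddCommGroup X] [NormedSpace 𝕜 X]

/-- The bound forces `f` to vanish on the kernel of `e`, so `f` descends to the range of `e`;
Hahn–Banach then extends it with the same norm. -/
theorem exists_strongDual_comp_eq {V : Type*} [AddCommGroup V] [Module 𝕜 V]
    (f : V →ₗ[𝕜] 𝕜) (e : V →ₗ[𝕜] X) {C : ℝ} (hC : 0 ≤ C) (h : ∀ v, ‖f v‖ ≤ C * ‖e v‖) :
    ∃ φ : StrongDual 𝕜 X, ‖φ‖ ≤ C ∧ ∀ v, φ (e v) = f v := by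
  have hd : DenseRange e.rangeRestrict := e.surjective_rangeRestrict.denseRange
  have hb : ∀ v, ‖f v‖ ≤ C * ‖e.rangeRestrict v‖ := h
  obtain ⟨φ, hφ, hn⟩ := exists_extension_norm_eq (LinearMap.range e)
    (f.extendOfNorm e.rangeRestrict)
  refine ⟨φ, ?_, fun v => ?_⟩
  · rw [hn]
    exact LinearMap.opNorm_extendOfNorm_le hd hC hb
  · exact (hφ (e.rangeRestrict v)).trans (LinearMap.extendOfNorm_eq hd ⟨C, hb⟩ v)

theorem linearCombination_mem_closedSpan {ι : Type*} (u : ι → X) (a : ι →₀ 𝕜) :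
    Finsupp.linearCombination 𝕜 u a ∈ closedSpan 𝕜 u :=
  Submodule.le_topologicalClosure _ <| by
    rw [← Finsupp.range_linearCombination]
    exact LinearMap.mem_range_self _ a

theorem exists_clm_closedSpan [CompleteSpace X] (u v : ℕ → X) (K : ℝ)
    (h : ∀ a : ℕ →₀ 𝕜,
      ‖Finsupp.linearCombination 𝕜 v a‖ ≤ K * ‖Finsupp.linearCombination 𝕜 u a‖) :
    ∃ T : closedSpan 𝕜 u →L[𝕜] closedSpan 𝕜 v,
      ∀ k, T ⟨u k, mem_closedSpan 𝕜 u k⟩ = ⟨v k, mem_closedSpan 𝕜 v k⟩ := by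
  have : CompleteSpace (closedSpan 𝕜 v) :=
    (Submodule.isClosed_topologicalClosure _).completeSpace_coe
  let e : (ℕ →₀ 𝕜) →ₗ[𝕜] closedSpan 𝕜 u :=
    (Finsupp.linearCombination 𝕜 u).codRestrict _ (linearCombination_mem_closedSpan u)
  let f : (ℕ →₀ 𝕜) →ₗ[𝕜] closedSpan 𝕜 v :=
    (Finsupp.linearCombination 𝕜 v).codRestrict _ (linearCombination_mem_closedSpan v)
  have hd : DenseRange e := by
    rintro ⟨w, hw⟩
    rw [closure_subtype]
    have hw' : w ∈ closure (Submodule.span 𝕜 (Set.range u) : Set X) := hw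
    convert hw' using 2
    rw [← Finsupp.range_linearCombination]
    ext z
    constructor
    · rintro ⟨_, ⟨a, rfl⟩, rfl⟩
      exact ⟨a, rfl⟩
    · rintro ⟨a, rfl⟩
      exact ⟨e a, ⟨a, rfl⟩, rfl⟩
  refine ⟨f.extendOfNorm e, fun k => ?_⟩
  have := LinearMap.extendOfNorm_eq (f := f) hd ⟨K, h⟩ (Finsupp.single k 1)
  convert this using 1
  · congr 1
    ext
    simp [e]
  · ext
    simp [f]

theorem IsBasicSequence.exists_norm_filter_le [CompleteSpace X] {x : ℕ → X}
    (hx : IsBasicSequence 𝕜 x) :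
    ∃ B : ℝ, 0 ≤ B ∧ ∀ (a : ℕ →₀ 𝕜) (n : ℕ),
      ‖Finsupp.linearCombination 𝕜 x (a.filter (· < n))‖ ≤
        B * ‖Finsupp.linearCombination 𝕜 x a‖ := by
  obtain ⟨b, hb⟩ := hx
  have : CompleteSpace (closedSpan 𝕜 x) :=
    (Submodule.isClosed_topologicalClosure _).completeSpace_coe
  obtain ⟨B, hB⟩ := b.exists_norm_proj_le
  have key : ∀ (a : ℕ →₀ 𝕜),
      ((Finsupp.linearCombination 𝕜 b a : closedSpan 𝕜 x) : X)
        = Finsupp.linearCombination 𝕜 x a := by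
    intro a
    simp [Finsupp.linearCombination_apply, Finsupp.sum, hb]
  have key2 : ∀ (n : ℕ) (a : ℕ →₀ 𝕜), b.proj n (Finsupp.linearCombination 𝕜 b a) =
      Finsupp.linearCombination 𝕜 b (a.filter (· < n)) := by
    intro n a
    induction a using Finsupp.induction_linear with
    | zero => simp [show (0 : ℕ →₀ 𝕜).filter (· < n) = 0 from Finsupp.filter_zero _]
    | add f g hf hg => rw [Finsupp.filter_add, map_add, map_add, map_add, hf, hg]
    | single i t =>
      by_cases h : i < n
      · rw [Finsupp.filter_single_of_pos (· < n) h,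
          Finsupp.linearCombination_single, map_smul, b.proj_apply_basis_mem, if_pos h]
      · rw [Finsupp.filter_single_of_neg (· < n) h,
          Finsupp.linearCombination_single, map_smul, b.proj_apply_basis_mem, if_neg h, smul_zero,
          map_zero]
  refine ⟨B, (norm_nonneg _).trans (hB 0), fun a n => ?_⟩
  rw [← key, ← key, ← key2]
  exact (b.proj n).le_of_opNorm_le (hB n) _

theorem linearCombination_mapDomain_filter_lt (x : ℕ → X) {m : ℕ → ℕ} (hm : StrictMono m)
    (a : ℕ →₀ 𝕜) (n : ℕ) :
    Finsupp.linearCombination 𝕜 x ((a.mapDomain m).filter (· < m n)) =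
      Finsupp.linearCombination 𝕜 (x ∘ m) (a.filter (· < n)) := by
  induction a using Finsupp.induction_linear with
  | zero =>
    rw [Finsupp.mapDomain_zero, Finsupp.filter_zero, Finsupp.filter_zero, map_zero, map_zero]
  | add f g hf hg =>
    rw [Finsupp.mapDomain_add, Finsupp.filter_add, Finsupp.filter_add, map_add, map_add, hf, hg]
  | single i t =>
    rw [Finsupp.mapDomain_single]
    by_cases h : i < n
    · rw [Finsupp.filter_single_of_pos (· < n) h,
        Finsupp.filter_single_of_pos (· < m n) (hm h)]
      simp
    · rw [Finsupp.filter_single_of_neg (· < n) h,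
        Finsupp.filter_single_of_neg (· < m n) (mt hm.lt_iff_lt.1 h)]
      simp

theorem IsBasicSequence.exists_norm_apply_le [CompleteSpace X] {x : ℕ → X}
    (hx : IsBasicSequence 𝕜 x) (hs : IsSeminormalized x) :
    ∃ D : ℝ, 0 < D ∧ ∀ (a : ℕ →₀ 𝕜) (i : ℕ),
      ‖a i‖ ≤ D * ‖Finsupp.linearCombination 𝕜 x a‖ := by
  obtain ⟨B, hB0, hB⟩ := hx.exists_norm_filter_le
  obtain ⟨m, M, hm, hM⟩ := hs
  refine ⟨(2 * B + 1) / m, by positivity, fun a i => ?_⟩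
  have h1 : Finsupp.linearCombination 𝕜 x (a.filter (· < i + 1)) =
      Finsupp.linearCombination 𝕜 x (a.filter (· < i)) + a i • x i := by
    have : a.filter (· < i + 1) = a.filter (· < i) + Finsupp.single i (a i) := by
      ext j
      rcases lt_trichotomy j i with h | rfl | h
      · simp [h, h.ne', h.le]
      · simp
      · simp [h.ne, h.not_gt, h.not_ge]
    rw [this, map_add, Finsupp.linearCombination_single]
  have h2 : ‖a i‖ * m ≤ (2 * B + 1) * ‖Finsupp.linearCombination 𝕜 x a‖ := by
    calc ‖a i‖ * m ≤ ‖a i‖ * ‖x i‖ := by gcongr; exact (hM i).1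
      _ = ‖a i • x i‖ := (norm_smul _ _).symm
      _ = ‖Finsupp.linearCombination 𝕜 x (a.filter (· < i + 1)) -
          Finsupp.linearCombination 𝕜 x (a.filter (· < i))‖ := by rw [h1, add_sub_cancel_left]
      _ ≤ B * ‖Finsupp.linearCombination 𝕜 x a‖ + B * ‖Finsupp.linearCombination 𝕜 x a‖ :=
        (norm_sub_le _ _).trans (add_le_add (hB _ _) (hB _ _))
      _ ≤ _ := by nlinarith [norm_nonneg (Finsupp.linearCombination 𝕜 x a)]
  rw [div_mul_eq_mul_div, le_div_iff₀ hm]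
  exact h2

end Extension

/-! ### Iterated weak* limits along an ultrafilter and the choice of the subsequence -/

section IteratedLimits

variable {𝕜 X : Type*} [RCLike 𝕜] [NormedAddCommGroup X] [NormedSpace 𝕜 X]

/-- Banach–Alaoglu: an ultrafilter on a weak*-compact ball converges. -/
theorem exists_hyperfilter_limit (ψ : ℕ → StrongDual 𝕜 X) {R : ℝ}
    (h : ∀ᶠ n in (hyperfilter ℕ : Filter ℕ), ‖ψ n‖ ≤ R) :
    ∃ φ : StrongDual 𝕜 X, ‖φ‖ ≤ R ∧
      ∀ x, Tendsto (fun n => ψ n x) (hyperfilter ℕ) (𝓝 (φ x)) := by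
  have hc := WeakDual.isCompact_closedBall (𝕜 := 𝕜) (E := X) 0 R
  let g : ℕ → WeakDual 𝕜 X := fun n => StrongDual.toWeakDual (ψ n)
  have hmem : ((hyperfilter ℕ).map g : Filter (WeakDual 𝕜 X)) ≤
      𝓟 (WeakDual.toStrongDual ⁻¹' Metric.closedBall (0 : StrongDual 𝕜 X) R) := by
    rw [le_principal_iff]
    have : ∀ᶠ n in (hyperfilter ℕ : Filter ℕ),
        g n ∈ WeakDual.toStrongDual ⁻¹' Metric.closedBall (0 : StrongDual 𝕜 X) R :=
      h.mono fun n hn => by simpa [g] using hn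
    exact this
  obtain ⟨φ, hφ, hl⟩ := hc.ultrafilter_le_nhds _ hmem
  refine ⟨WeakDual.toStrongDual φ, by simpa using hφ, fun x => ?_⟩
  have hg : Tendsto g (hyperfilter ℕ) (𝓝 φ) := hl
  exact ((WeakDual.eval_continuous x).tendsto φ).comp hg

/-- `Ψ d F` is the functional attached to `F` with `d` further elements still to be added, these
having been sent to infinity one after another along the ultrafilter. Bounds depending only on
cardinality survive each limit, because the added point is eventually outside `F`. -/
theorem exists_iterated_limits (Φ : Finset ℕ → StrongDual 𝕜 X) (R : ℕ → ℝ)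
    (h : ∀ F, ‖Φ F‖ ≤ R F.card) :
    ∃ Ψ : ℕ → Finset ℕ → StrongDual 𝕜 X, Ψ 0 = Φ ∧ ∀ d F x,
      Tendsto (fun n => Ψ d (insert n F) x) (hyperfilter ℕ) (𝓝 (Ψ (d + 1) F x)) := by
  classical
  have step : ∀ (d : ℕ) (Ψ : {Ψ : Finset ℕ → StrongDual 𝕜 X // ∀ F, ‖Ψ F‖ ≤ R (F.card + d)}),
      ∃ Ψ' : {Ψ : Finset ℕ → StrongDual 𝕜 X // ∀ F, ‖Ψ F‖ ≤ R (F.card + (d + 1))},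
        ∀ F x, Tendsto (fun n => Ψ.1 (insert n F) x) (hyperfilter ℕ) (𝓝 (Ψ'.1 F x)) := by
    rintro d ⟨Ψ, hΨ⟩
    have : ∀ F : Finset ℕ, ∃ φ : StrongDual 𝕜 X, ‖φ‖ ≤ R (F.card + (d + 1)) ∧
        ∀ x, Tendsto (fun n => Ψ (insert n F) x) (hyperfilter ℕ) (𝓝 (φ x)) := by
      intro F
      apply exists_hyperfilter_limit
      have : ∀ᶠ n in (hyperfilter ℕ : Filter ℕ), n ∉ F :=
        hyperfilter_le_cofinite F.finite_toSet.compl_mem_cofinite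
      filter_upwards [this] with n hn
      have := hΨ (insert n F)
      rwa [Finset.card_insert_of_notMem hn, add_assoc, add_comm 1] at this
    choose Ψ' h1 h2 using this
    exact ⟨⟨Ψ', h1⟩, h2⟩
  choose next hnext using step
  let Ψ : ∀ d, {Ψ : Finset ℕ → StrongDual 𝕜 X // ∀ F, ‖Ψ F‖ ≤ R (F.card + d)} :=
    fun d => Nat.rec ⟨Φ, h⟩ next d
  exact ⟨fun d => (Ψ d).1, rfl, fun d F x => hnext d (Ψ d) F x⟩

/-- Recursive selection: `S` plays the role of the set of terms already chosen. -/
theorem exists_strictMono_of_hyperfilter (P : Finset ℕ → ℕ → Prop)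
    (h : ∀ S, ∀ᶠ n in (hyperfilter ℕ : Filter ℕ), P S n) :
    ∃ m : ℕ → ℕ, StrictMono m ∧ ∀ k, P ((Finset.range k).image m) (m k) := by
  classical
  have h' : ∀ S : Finset ℕ, ∃ n, P S n ∧ ∀ s ∈ S, s < n := by
    intro S
    have : ∀ᶠ n in (hyperfilter ℕ : Filter ℕ), ∀ s ∈ S, s < n := by
      apply Filter.Eventually.filter_mono Nat.hyperfilter_le_atTop
      exact (Finset.eventually_all S).2 fun s _ => eventually_gt_atTop s
    exact ((h S).and this).exists
  choose g hg1 hg2 using h'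
  let S : ℕ → Finset ℕ := fun k => Nat.rec ∅ (fun _ T => insert (g T) T) k
  have hS : ∀ k, S (k + 1) = insert (g (S k)) (S k) := fun k => rfl
  have himg : ∀ k, (Finset.range k).image (fun k => g (S k)) = S k := by
    intro k
    induction k with
    | zero => rfl
    | succ k ih => rw [Finset.range_add_one, Finset.image_insert, ih, hS]
  refine ⟨fun k => g (S k), strictMono_nat_of_lt_succ fun k => ?_, fun k => ?_⟩
  · exact hg2 _ _ (by rw [hS]; exact Finset.mem_insert_self _ _)
  · rw [himg]
    exact hg1 _

/-- When `m j` is chosen, every limit functional built on earlier terms is already fixed, so weak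
nullness makes it small at `x (m j)`. Each later element of `F` is chosen so that replacing a limit
by its actual value costs little at the earlier `x (m j)`. The bound `H` leaves finitely many
conditions at each stage. -/
theorem exists_subsequence_small_off_support (x : ℕ → X) (hx : IsWeaklyNull 𝕜 x)
    (Φ : Finset ℕ → StrongDual 𝕜 X) (R : ℕ → ℝ) (hΦ : ∀ F, ‖Φ F‖ ≤ R F.card)
    (H : ℕ → ℕ) (hH : Monotone H) (N : ℕ → ℕ) :
    ∃ m : ℕ → ℕ, StrictMono m ∧ (∀ k, N k ≤ m k) ∧
      ∀ (k : ℕ) (F : Finset ℕ), (∀ i ∈ F, k ≤ i) → F.card ≤ H k →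
        ∀ j, k ≤ j → j ∉ F → ‖Φ (F.image m) (x (m j))‖ ≤ 2 * (1 / 2) ^ j := by
  classical
  obtain ⟨Ψ, hΨ0, hΨ⟩ := exists_iterated_limits Φ R hΦ
  obtain ⟨m, hm, hP⟩ := exists_strictMono_of_hyperfilter
    (fun S n => (∀ F ∈ S.powerset, ∀ d ∈ Finset.range (H S.card + 1),
        ‖Ψ d F (x n)‖ ≤ (1 / 2) ^ S.card) ∧
      (∀ F ∈ S.powerset, ∀ d ∈ Finset.range (H S.card + 1), ∀ j ∈ S,
        ‖Ψ d (insert n F) (x j) - Ψ (d + 1) F (x j)‖ ≤ (1 / 2) ^ S.card) ∧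
      N S.card ≤ n) <| by
    intro S
    have hpos : (0 : ℝ) < (1 / 2) ^ S.card := by positivity
    refine Filter.Eventually.and ?_ (Filter.Eventually.and ?_ ?_)
    · refine (Finset.eventually_all _).2 fun F _ => (Finset.eventually_all _).2 fun d _ => ?_
      have := ((hx (Ψ d F)).mono_left Nat.hyperfilter_le_atTop).norm
      rw [norm_zero] at this
      exact this.eventually_le_const hpos
    · refine (Finset.eventually_all _).2 fun F _ => (Finset.eventually_all _).2 fun d _ =>
        (Finset.eventually_all _).2 fun j _ => ?_
      have := (hΨ d F (x j)).sub_const (Ψ (d + 1) F (x j)) |>.norm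
      rw [sub_self, norm_zero] at this
      exact this.eventually_le_const hpos
    · exact Filter.Eventually.filter_mono Nat.hyperfilter_le_atTop (eventually_ge_atTop _)
  have hcard : ∀ k, ((Finset.range k).image m).card = k := fun k => by
    rw [Finset.card_image_of_injective _ hm.injective, Finset.card_range]
  simp only [hcard, Finset.mem_powerset, Finset.mem_range, Nat.lt_succ_iff] at hP
  refine ⟨m, hm, fun k => (hP k).2.2, fun k F hF hFc j hkj hj => ?_⟩
  have hsub : ∀ t, (F.filter (· < t)).image m ⊆ (Finset.range t).image m := fun t =>
    Finset.image_subset_image fun i hi => by simpa using (Finset.mem_filter.1 hi).2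
  have hHj : ∀ t, j ≤ t → F.card ≤ H t := fun t ht => hFc.trans (hH (hkj.trans ht))
  -- Reveal `F` in increasing order: at time `t` the elements below `t` are in place and the
  -- remaining ones are still limits. The errors `2^(-t)` telescope, and once all of `F` is revealed
  -- the functional is `Φ (F.image m)`.
  have main : ∀ t, j + 1 ≤ t →
      ‖Ψ (F.card - (F.filter (· < t)).card) ((F.filter (· < t)).image m) (x (m j))‖ ≤
        2 * (1 / 2) ^ j - 2 * (1 / 2) ^ t := by
    intro t ht
    induction t, ht using Nat.le_induction with
    | base =>
      have : F.filter (· < j + 1) = F.filter (· < j) := by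
        ext i
        simp only [Finset.mem_filter]
        refine and_congr_right fun hi => ?_
        have : i ≠ j := fun h => hj (h ▸ hi)
        omega
      rw [this]
      refine ((hP j).1 _ (hsub j) _ ((Nat.sub_le _ _).trans (hHj j le_rfl))).trans (le_of_eq ?_)
      rw [pow_succ]
      ring
    | succ t ht ih =>
      have hpw : (1 / 2 : ℝ) ^ (t + 1) = (1 / 2) ^ t / 2 := by rw [pow_succ]; ring
      by_cases htF : t ∈ F
      · have hins : F.filter (· < t + 1) = insert t (F.filter (· < t)) := by
          ext i
          simp only [Finset.mem_filter, Finset.mem_insert]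
          constructor
          · rintro ⟨h1, h2⟩
            by_cases h : i = t
            · exact Or.inl h
            · exact Or.inr ⟨h1, by omega⟩
          · rintro (rfl | ⟨h1, h2⟩)
            · exact ⟨htF, by omega⟩
            · exact ⟨h1, by omega⟩
        have hnot : t ∉ F.filter (· < t) := by simp
        have hlt : (F.filter (· < t)).card < F.card := by
          apply Finset.card_lt_card
          exact (Finset.filter_ssubset).2 ⟨t, htF, lt_irrefl t⟩
        rw [hins, Finset.card_insert_of_notMem hnot, Finset.image_insert]
        -- Placing `t` uses up one limit, so the depth must be exhibited as a successor.
        have hd : F.card - (F.filter (· < t)).card =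
            F.card - ((F.filter (· < t)).card + 1) + 1 := by omega
        rw [hd] at ih
        have := (hP t).2.1 _ (hsub t) (F.card - ((F.filter (· < t)).card + 1))
          ((Nat.sub_le _ _).trans (hHj t (by omega))) (m j)
          (Finset.mem_image_of_mem _ (by simpa using ht))
        have h3 := norm_le_norm_add_norm_sub
          (Ψ (F.card - ((F.filter (· < t)).card + 1) + 1) ((F.filter (· < t)).image m) (x (m j)))
          (Ψ (F.card - ((F.filter (· < t)).card + 1))
            (insert (m t) ((F.filter (· < t)).image m)) (x (m j)))
        rw [norm_sub_rev] at h3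
        linarith
      · have : F.filter (· < t + 1) = F.filter (· < t) := by
          ext i
          simp only [Finset.mem_filter]
          refine and_congr_right fun hi => ?_
          have : i ≠ t := fun h => htF (h ▸ hi)
          omega
        rw [this]
        have : (0 : ℝ) < (1 / 2) ^ t := by positivity
        linarith
  obtain ⟨t, ht⟩ := F.bddAbove
  have hall : F.filter (· < max (j + 1) (t + 1)) = F :=
    Finset.filter_true_of_mem fun i hi => by
      have : i ≤ t := ht hi
      omega
  have := main (max (j + 1) (t + 1)) (le_max_left _ _)
  rw [hall, Nat.sub_self, hΨ0] at this
  have h0 : (0 : ℝ) < (1 / 2) ^ max (j + 1) (t + 1) := by positivity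
  linarith

end IteratedLimits

end

noncomputable section

/-! ### Powers of the logarithm -/

section PowerOfLog

theorem one_le_logb_two_add_one {t : ℝ} (ht : 1 ≤ t) : 1 ≤ Real.logb 2 (t + 1) := by
  rw [Real.le_logb_iff_rpow_le (by norm_num) (by linarith), Real.rpow_one]
  linarith

theorem fPow_pos (p : ℝ) {t : ℝ} (ht : 1 ≤ t) : 0 < fPow p t :=
  Real.rpow_pos_of_pos (one_pos.trans_le (one_le_logb_two_add_one ht)) _

theorem one_le_fPow {p t : ℝ} (hp : 0 ≤ p) (ht : 1 ≤ t) : 1 ≤ fPow p t :=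
  Real.one_le_rpow (one_le_logb_two_add_one ht) hp

theorem fPow_nonneg (p : ℝ) {t : ℝ} (ht : 0 ≤ t) : 0 ≤ fPow p t :=
  Real.rpow_nonneg (Real.logb_nonneg (by norm_num) (by linarith)) _

theorem fPow_mono {p s t : ℝ} (hp : 0 ≤ p) (hs : 0 ≤ s) (hst : s ≤ t) : fPow p s ≤ fPow p t := by
  unfold fPow
  have h0 := Real.logb_nonneg (b := 2) (by norm_num) (show (1 : ℝ) ≤ s + 1 by linarith)
  have h1 := Real.logb_le_logb_of_le (b := 2) (by norm_num) (show (0 : ℝ) < s + 1 by linarith)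
    (show s + 1 ≤ t + 1 by linarith)
  gcongr

theorem fPow_add (p q : ℝ) {t : ℝ} (ht : 1 ≤ t) : fPow (p + q) t = fPow p t * fPow q t :=
  Real.rpow_add (one_pos.trans_le (one_le_logb_two_add_one ht)) _ _

theorem eventually_mul_fPow_lt (p : ℝ) {c : ℝ} (hc : 0 < c) (K : ℝ) :
    ∀ᶠ n : ℕ in atTop, K * fPow p n < c * n := by
  have h1 : (fun t : ℝ => Real.log t ^ p) =o[atTop] fun t => t := by
    simpa using isLittleO_log_rpow_rpow_atTop p one_pos
  have ht : Tendsto (fun n : ℕ => (n : ℝ) + 1) atTop atTop :=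
    tendsto_atTop_add_const_right _ _ tendsto_natCast_atTop_atTop
  have h2 := h1.comp_tendsto ht
  have hl : 0 < Real.log 2 := Real.log_pos (by norm_num)
  have hl' : 0 < Real.log 2 ^ p := Real.rpow_pos_of_pos hl p
  have hε : 0 < c / 4 / (|K| + 1) * Real.log 2 ^ p := by positivity
  filter_upwards [h2.bound hε, eventually_ge_atTop 1] with n hn hn1
  have hn1' : (1 : ℝ) ≤ n := by exact_mod_cast hn1
  have hlog : 0 ≤ Real.log ((n : ℝ) + 1) := Real.log_nonneg (by linarith)
  have hf : fPow p n = Real.log ((n : ℝ) + 1) ^ p / Real.log 2 ^ p := by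
    rw [fPow, Real.logb, Real.div_rpow hlog hl.le]
  simp only [Function.comp, Real.norm_eq_abs] at hn
  rw [abs_of_nonneg (Real.rpow_nonneg hlog p), abs_of_pos (by linarith : (0 : ℝ) < n + 1)] at hn
  have h3 : fPow p n ≤ c / 4 / (|K| + 1) * (n + 1) := by
    rw [hf, div_le_iff₀ hl']
    linarith
  calc K * fPow p n ≤ (|K| + 1) * fPow p n := by
        gcongr
        · exact fPow_nonneg _ (by linarith)
        · linarith [le_abs_self K]
    _ ≤ (|K| + 1) * (c / 4 / (|K| + 1) * (n + 1)) := by gcongr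
    _ = c / 4 * (n + 1) := by field_simp
    _ < c * n := by nlinarith

end PowerOfLog

/-! ### Abel summation against logarithmic weights, and the level thresholds -/

section Summation

/-- Discrete form of `g^p d(g^(-s)) = s/(s-p) d(g^(p-s))`, making the Abel summation below
telescope. After dividing by `g^(p-s)` it is Bernoulli's inequality for the exponent `(s-p)/s ≤ 1`
at `z = (h/g)^(-s)`. -/
theorem rpow_mul_sub_le {g h p s : ℝ} (hg : 0 < g) (hgh : g ≤ h) (hp : 0 < p) (hps : p < s) :
    g ^ p * (g ^ (-s) - h ^ (-s)) ≤ s / (s - p) * (g ^ (p - s) - h ^ (p - s)) := by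
  have hs : 0 < s := hp.trans hps
  have hh : 0 < h := hg.trans_le hgh
  have hsp : 0 < s - p := sub_pos.2 hps
  set z : ℝ := (h / g) ^ (-s) with hz
  have hz0 : 0 < z := Real.rpow_pos_of_pos (div_pos hh hg) _
  have hzβ : z ^ ((s - p) / s) = (h / g) ^ (p - s) := by
    rw [hz, ← Real.rpow_mul (div_pos hh hg).le]
    congr 1
    field_simp
    ring
  have hB := rpow_one_add_le_one_add_mul_self (s := z - 1) (by linarith)
    (div_pos hsp hs).le ((div_le_one hs).2 (by linarith))
  rw [add_sub_cancel, hzβ] at hB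
  have e1 : h ^ (-s) = g ^ (-s) * z := by
    rw [hz, Real.div_rpow hh.le hg.le]
    field_simp [(Real.rpow_pos_of_pos hg (-s)).ne']
  have e2 : h ^ (p - s) = g ^ (p - s) * (h / g) ^ (p - s) := by
    rw [Real.div_rpow hh.le hg.le]
    field_simp [(Real.rpow_pos_of_pos hg (p - s)).ne']
  have e3 : g ^ p * g ^ (-s) = g ^ (p - s) := by
    rw [← Real.rpow_add hg, sub_eq_add_neg]
  have hgp : 0 < g ^ (p - s) := Real.rpow_pos_of_pos hg _
  calc g ^ p * (g ^ (-s) - h ^ (-s)) = g ^ (p - s) * (1 - z) := by rw [e1, ← e3]; ring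
    _ ≤ g ^ (p - s) * (s / (s - p) * (1 - (h / g) ^ (p - s))) := by
        gcongr
        rw [div_mul_eq_mul_div, le_div_iff₀ hsp]
        have : s * ((s - p) / s * (z - 1)) = (s - p) * (z - 1) := by field_simp
        nlinarith
    _ = _ := by rw [e2]; ring

theorem sum_div_fPow_le {p s K : ℝ} (hp : 0 < p) (hps : p < s) (hK : 0 ≤ K) (r : ℕ → ℝ)
    (hr : ∀ l : ℕ, ∑ i ∈ Finset.range l, r i ≤ K * fPow p l) (n : ℕ) :
    ∑ i ∈ Finset.range n, 1 / fPow s ((i : ℝ) + 1) * r i ≤ K * (s / (s - p)) := by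
  have hs : 0 < s := hp.trans hps
  have hsp : 0 < s - p := sub_pos.2 hps
  have hβ : 1 ≤ s / (s - p) := (one_le_div hsp).2 (by linarith)
  let g : ℕ → ℝ := fun i => Real.logb 2 ((i : ℝ) + 1 + 1)
  have hg1 : ∀ i, 1 ≤ g i := fun i => one_le_logb_two_add_one (by linarith [i.cast_nonneg (α := ℝ)])
  have hg0 : ∀ i, 0 < g i := fun i => one_pos.trans_le (hg1 i)
  have hgm : ∀ i, g i ≤ g (i + 1) := fun i => by
    refine Real.logb_le_logb_of_le (by norm_num) (by positivity) ?_
    push_cast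
    linarith
  have hw : ∀ i : ℕ, 1 / fPow s ((i : ℝ) + 1) = g i ^ (-s) := fun i => by
    rw [Real.rpow_neg (hg0 i).le, one_div, fPow]
  have hr' : ∀ i : ℕ, ∑ j ∈ Finset.range (i + 1), r j ≤ K * g i ^ p := fun i => by
    have := hr (i + 1)
    rw [fPow] at this
    push_cast at this
    exact this
  simp only [hw]
  -- Abel summation: the boundary term is kept, and the weight differences are dominated by a
  -- telescoping sum. At the end the boundary term is absorbed by the subtracted `g n ^ (p - s)`, as
  -- `s / (s - p) ≥ 1`.
  have main : ∀ n : ℕ, ∑ i ∈ Finset.range (n + 1), g i ^ (-s) * r i ≤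
      (∑ i ∈ Finset.range (n + 1), r i) * g n ^ (-s) +
        K * (s / (s - p)) * (1 - g n ^ (p - s)) := by
    intro n
    induction n with
    | zero =>
      have : g 0 ^ (p - s) ≤ 1 := Real.rpow_le_one_of_one_le_of_nonpos (hg1 0) (by linarith)
      have h2 : 0 ≤ K * (s / (s - p)) * (1 - g 0 ^ (p - s)) :=
        mul_nonneg (by positivity) (by linarith)
      simp only [zero_add, Finset.sum_range_one]
      linarith
    | succ n ih =>
      rw [Finset.sum_range_succ, Finset.sum_range_succ _ (n + 1)]
      have h1 := rpow_mul_sub_le (hg0 n) (hgm n) hp hps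
      have h2 : 0 ≤ g n ^ (-s) - g (n + 1) ^ (-s) :=
        sub_nonneg.2 (Real.rpow_le_rpow_of_nonpos (hg0 n) (hgm n) (by linarith))
      have h3 := mul_le_mul_of_nonneg_right (hr' n) h2
      have h4 := mul_le_mul_of_nonneg_left h1 hK
      linarith
  cases n with
  | zero =>
    simp only [Finset.range_zero, Finset.sum_empty]
    positivity
  | succ n =>
    have h1 : 0 < g n ^ (-s) := Real.rpow_pos_of_pos (hg0 n) _
    have h2 := mul_le_mul_of_nonneg_right (hr' n) h1.le
    have h3 : K * g n ^ p * g n ^ (-s) = K * g n ^ (p - s) := by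
      rw [mul_assoc, ← Real.rpow_add (hg0 n), sub_eq_add_neg]
    have h4 : 0 ≤ K * g n ^ (p - s) := mul_nonneg hK (Real.rpow_nonneg (hg0 n).le _)
    have h5 := mul_le_mul_of_nonneg_left hβ h4
    have := main n
    linarith

/-- The threshold below which the coordinates of level at least `k` lie. -/
def levelThreshold (k : ℕ) : ℝ := (1 / 4) ^ 2 ^ k

theorem levelThreshold_pos (k : ℕ) : 0 < levelThreshold k := by
  unfold levelThreshold
  positivity

/-- The reason for double exponential thresholds: `2^(2^k)` coordinates of level `k` have a small
sum, yet beyond index `2^(2^k)` the logarithm already exceeds `2^k`. -/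
theorem two_pow_two_pow_mul_levelThreshold_le (k : ℕ) :
    2 ^ 2 ^ k * levelThreshold k ≤ (1 / 2) ^ k := by
  have h1 : (2 : ℝ) ^ 2 ^ k * levelThreshold k = (1 / 2) ^ 2 ^ k := by
    rw [levelThreshold, ← mul_pow]
    norm_num
  rw [h1]
  exact pow_le_pow_of_le_one (by norm_num) (by norm_num) Nat.lt_two_pow_self.le

theorem natCast_mul_levelThreshold_le (k : ℕ) : k * levelThreshold k ≤ (1 / 2) ^ k := by
  refine le_trans ?_ (two_pow_two_pow_mul_levelThreshold_le k)
  have : (k : ℝ) ≤ 2 ^ 2 ^ k := by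
    exact_mod_cast (Nat.lt_two_pow_self.trans Nat.lt_two_pow_self).le
  exact mul_le_mul_of_nonneg_right this (levelThreshold_pos k).le

theorem levelThreshold_le (k : ℕ) : levelThreshold k ≤ (1 / 2) ^ k := by
  refine le_trans ?_ (two_pow_two_pow_mul_levelThreshold_le k)
  have : (1 : ℝ) ≤ 2 ^ 2 ^ k := one_le_pow₀ (by norm_num)
  nlinarith [levelThreshold_pos k]

theorem exists_levelThreshold_lt {t : ℝ} (ht : 0 < t) : ∃ k, levelThreshold (k + 1) < t := by
  obtain ⟨k, hk⟩ := exists_pow_lt_of_lt_one ht (show (1 / 2 : ℝ) < 1 by norm_num)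
  refine ⟨k, ((levelThreshold_le _).trans ?_).trans_lt hk⟩
  exact pow_le_pow_of_le_one (by norm_num) (by norm_num) (Nat.le_succ k)

/-- The bound for the `f ^ q`-Lorentz norm of a sequence whose coordinates are at most
`levelThreshold k` and whose `f ^ p`-norm is at most `K`. -/
def levelBound (p q K : ℝ) (k : ℕ) : ℝ :=
  (1 / 2) ^ k + (2 ^ (-((q - p) / 2)) : ℝ) ^ k *
    (K * ((p + (q - p) / 2) / ((p + (q - p) / 2) - p)))

theorem summable_levelBound {p q : ℝ} (hpq : p < q) (K : ℝ) :
    Summable (levelBound p q K) := by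
  refine Summable.add (summable_geometric_of_lt_one (by norm_num) (by norm_num)) ?_
  refine Summable.mul_right _ (summable_geometric_of_lt_one (by positivity) ?_)
  exact Real.rpow_lt_one_of_one_lt_of_neg (by norm_num) (by linarith)

theorem sum_div_fPow_le_levelBound {p q K : ℝ} (hp : 0 < p) (hpq : p < q) (hK : 0 ≤ K)
    (r : ℕ → ℝ) (hr0 : ∀ i, 0 ≤ r i)
    (hr : ∀ l : ℕ, ∑ i ∈ Finset.range l, r i ≤ K * fPow p l) (k : ℕ)
    (hrk : ∀ i, r i ≤ levelThreshold k) (n : ℕ) :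
    ∑ i ∈ Finset.range n, 1 / fPow q ((i : ℝ) + 1) * r i ≤ levelBound p q K k := by
  set η := (q - p) / 2 with hη
  have hη0 : 0 < η := by rw [hη]; linarith
  -- Split at `2^(2^k)`. Before it the weight is at most `1`; after it, `f^q = f^(p+η) f^η` with
  -- `f^η ≥ 2^(ηk)`, and the exponent `p + η > p` that is left suffices for Abel summation.
  have hterm : ∀ i : ℕ, 1 / fPow q ((i : ℝ) + 1) * r i ≤
      (if i < 2 ^ 2 ^ k then levelThreshold k else 0) +
        (2 ^ (-η) : ℝ) ^ k * (1 / fPow (p + η) ((i : ℝ) + 1) * r i) := by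
    intro i
    have hi : (1 : ℝ) ≤ (i : ℝ) + 1 := by linarith [i.cast_nonneg (α := ℝ)]
    have hnn : 0 ≤ (2 ^ (-η) : ℝ) ^ k * (1 / fPow (p + η) ((i : ℝ) + 1) * r i) :=
      mul_nonneg (by positivity)
        (mul_nonneg (one_div_nonneg.2 (fPow_pos _ hi).le) (hr0 i))
    split_ifs with h
    · have h1 : 1 / fPow q ((i : ℝ) + 1) ≤ 1 :=
        (div_le_one (fPow_pos _ hi)).2 (one_le_fPow (by linarith) hi)
      have h2 := mul_le_mul_of_nonneg_right h1 (hr0 i)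
      linarith [hrk i]
    · rw [zero_add, ← mul_assoc]
      refine mul_le_mul_of_nonneg_right ?_ (hr0 i)
      have hlog : (2 : ℝ) ^ k ≤ Real.logb 2 ((i : ℝ) + 1 + 1) := by
        rw [Real.le_logb_iff_rpow_le (by norm_num) (by linarith)]
        have h3 : ((2 ^ 2 ^ k : ℕ) : ℝ) ≤ i := by exact_mod_cast not_lt.1 h
        push_cast at h3
        have h4 : (2 : ℝ) ^ ((2 : ℝ) ^ k) = 2 ^ 2 ^ k := by
          rw [← Real.rpow_natCast 2 (2 ^ k)]
          push_cast
          rfl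
        rw [h4]
        linarith
      have h5 : (2 ^ η : ℝ) ^ k ≤ fPow η ((i : ℝ) + 1) := by
        rw [← Real.rpow_mul_natCast (by norm_num), mul_comm, Real.rpow_natCast_mul (by norm_num)]
        exact Real.rpow_le_rpow (by positivity) hlog hη0.le
      have hqe : q = p + η + η := by rw [hη]; ring
      rw [hqe, fPow_add _ _ hi, Real.rpow_neg (by norm_num), inv_pow, one_div, one_div,
        mul_inv, mul_comm]
      refine mul_le_mul_of_nonneg_right ?_ (inv_nonneg.2 (fPow_pos _ hi).le)
      exact inv_anti₀ (by positivity) h5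
  refine (Finset.sum_le_sum fun i _ => hterm i).trans ?_
  rw [Finset.sum_add_distrib, ← Finset.mul_sum, levelBound]
  refine add_le_add ?_ (mul_le_mul_of_nonneg_left ?_ (by positivity))
  · rw [← Finset.sum_filter, Finset.sum_const, nsmul_eq_mul]
    refine le_trans ?_ (two_pow_two_pow_mul_levelThreshold_le k)
    refine mul_le_mul_of_nonneg_right ?_ (levelThreshold_pos k).le
    have : ((Finset.range n).filter (· < 2 ^ 2 ^ k)).card ≤ 2 ^ 2 ^ k := by
      calc _ ≤ (Finset.range (2 ^ 2 ^ k)).card :=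
            Finset.card_le_card fun i hi => by simpa using (Finset.mem_filter.1 hi).2
        _ = _ := Finset.card_range _
    exact_mod_cast this
  · exact sum_div_fPow_le hp (by linarith) hK r hr n

end Summation

/-! ### Decreasing rearrangements -/

section Rearrangement

variable {𝕜 : Type*} [RCLike 𝕜]

theorem decrRearr_mem_or (a : ℕ →₀ 𝕜) (i : ℕ) :
    decrRearr a i = 0 ∨ ∃ j, decrRearr a i = ‖a j‖ := by
  unfold decrRearr
  set L := (a.support.val.map fun j => ‖a j‖).sort (· ≥ ·) with hL
  rcases lt_or_ge i L.length with h | h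
  · right
    rw [List.getD_eq_getElem _ _ h]
    have : L[i] ∈ a.support.val.map fun j => ‖a j‖ := by
      rw [← Multiset.mem_sort (· ≥ ·)]
      exact List.getElem_mem h
    obtain ⟨j, -, hj⟩ := Multiset.mem_map.1 this
    exact ⟨j, hj.symm⟩
  · left
    exact List.getD_eq_default _ _ h

/-- Turns bounds on sums over finite sets into bounds on partial sums of the rearrangement. The
cardinality can be less than `l` because the rearrangement is padded by zeros. -/
theorem exists_sum_decrRearr_eq (a : ℕ →₀ 𝕜) (l : ℕ) :
    ∃ F : Finset ℕ, F.card ≤ l ∧ ∑ i ∈ Finset.range l, decrRearr a i = ∑ i ∈ F, ‖a i‖ := by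
  classical
  unfold decrRearr
  set L := (a.support.val.map fun j => ‖a j‖).sort (· ≥ ·) with hL
  have hsum : ∑ i ∈ Finset.range l, L.getD i 0 = (L.take l).sum := by
    induction l with
    | zero => simp
    | succ l ih =>
      rw [Finset.sum_range_succ, ih]
      rcases lt_or_ge l L.length with h | h
      · rw [List.getD_eq_getElem _ _ h, List.sum_take_succ _ _ h]
      · rw [List.getD_eq_default _ _ h, List.take_of_length_le h,
          List.take_of_length_le (h.trans (Nat.le_succ l)), add_zero]
  have hperm : L.Perm (a.support.toList.map fun j => ‖a j‖) := by
    rw [← Multiset.coe_eq_coe, hL, Multiset.sort_eq, ← Multiset.map_coe, Finset.coe_toList]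
  obtain ⟨l', hl', hs⟩ := ((List.take_sublist l L).subperm).trans hperm.subperm
  obtain ⟨t, ht, rfl⟩ := List.sublist_map_iff.1 hs
  have hnd : t.Nodup := a.support.nodup_toList.sublist ht
  refine ⟨t.toFinset, ?_, ?_⟩
  · rw [List.toFinset_card_of_nodup hnd]
    have := hl'.length_eq
    rw [List.length_map, List.length_take] at this
    omega
  · rw [hsum, ← hl'.sum_eq, List.sum_toFinset _ hnd]

theorem gLorentzNorm_le_levelBound {p q K : ℝ} (hp : 0 < p) (hpq : p < q) (hK : 0 ≤ K)
    (a : ℕ →₀ 𝕜) (ha : ∀ F : Finset ℕ, ∑ i ∈ F, ‖a i‖ ≤ K * fPow p F.card) (k : ℕ)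
    (hak : ∀ i, ‖a i‖ ≤ levelThreshold k) :
    gLorentzNorm (fPow q) a ≤ levelBound p q K k := by
  refine sum_div_fPow_le_levelBound hp hpq hK _ (fun i => ?_) (fun l => ?_) k (fun i => ?_) _
  · rcases decrRearr_mem_or a i with h | ⟨j, h⟩ <;> rw [h]
    exact norm_nonneg _
  · obtain ⟨F, hF, h⟩ := exists_sum_decrRearr_eq a l
    rw [h]
    refine (ha F).trans (mul_le_mul_of_nonneg_left ?_ hK)
    exact fPow_mono hp.le (Nat.cast_nonneg _) (Nat.cast_le.2 hF)
  · rcases decrRearr_mem_or a i with h | ⟨j, h⟩ <;> rw [h]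
    exacts [(levelThreshold_pos k).le, hak j]

end Rearrangement

/-! ### Decomposition of the coordinates into levels -/

section Levels

variable {𝕜 Y : Type*} [RCLike 𝕜] [NormedAddCommGroup Y] [NormedSpace 𝕜 Y]

theorem exists_level {t : ℝ} (ht : 0 < t) (ht' : t ≤ 1 / 4) :
    ∃ k, levelThreshold (k + 1) < t ∧ t ≤ levelThreshold k := by
  classical
  refine ⟨Nat.find (exists_levelThreshold_lt ht), Nat.find_spec (exists_levelThreshold_lt ht), ?_⟩
  rcases h : Nat.find (exists_levelThreshold_lt ht) with _ | k
  · simpa [levelThreshold] using ht'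
  · exact not_lt.1 (Nat.find_min (exists_levelThreshold_lt ht) (by omega : k < _))

theorem norm_sum_smul_le_of_levels {p K M : ℝ} (hM : 0 ≤ M) (H : ℕ → ℕ)
    (hH : ∀ k, K * fPow p (H k) < levelThreshold (k + 1) * H k)
    (G : ℕ → ℝ) (hG0 : ∀ k, 0 ≤ G k) (hG : Summable G) (z : ℕ → Y) (hz : ∀ i, ‖z i‖ ≤ M)
    (a : ℕ →₀ 𝕜) (ha : ∀ i, ‖a i‖ ≤ 1 / 4)
    (haF : ∀ (k : ℕ) (F : Finset ℕ), (∀ i ∈ F, k ≤ i) → F.card ≤ H k →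
      ∑ i ∈ F, ‖a i‖ ≤ K * fPow p F.card)
    (hzF : ∀ (k : ℕ) (F : Finset ℕ), (∀ i ∈ F, k ≤ i) → F.card ≤ H k →
      (∀ i ∈ F, ‖a i‖ ≤ levelThreshold k) →
      (∀ F' ⊆ F, ∑ i ∈ F', ‖a i‖ ≤ K * fPow p F'.card) → ‖∑ i ∈ F, a i • z i‖ ≤ G k) :
    ‖∑ i ∈ a.support, a i • z i‖ ≤ ∑' k, (M * (1 / 2) ^ k + G k) := by
  classical
  have hlev : ∀ i, ∃ k, i ∈ a.support →
      levelThreshold (k + 1) < ‖a i‖ ∧ ‖a i‖ ≤ levelThreshold k := by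
    intro i
    by_cases hi : i ∈ a.support
    · obtain ⟨k, hk⟩ := exists_level (norm_pos_iff.2 (Finsupp.mem_support_iff.1 hi)) (ha i)
      exact ⟨k, fun _ => hk⟩
    · exact ⟨0, fun h => absurd h hi⟩
  choose lev hlev using hlev
  have hterm : ∀ k, ‖∑ i ∈ a.support with lev i = k, a i • z i‖ ≤ M * (1 / 2) ^ k + G k := by
    intro k
    set A := a.support.filter fun i => lev i = k with hA
    have hA1 : ∀ i ∈ A, levelThreshold (k + 1) < ‖a i‖ ∧ ‖a i‖ ≤ levelThreshold k := by
      intro i hi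
      obtain ⟨h1, h2⟩ := Finset.mem_filter.1 hi
      exact h2 ▸ hlev i h1
    rw [← Finset.sum_filter_add_sum_filter_not A (· < k)]
    refine (norm_add_le _ _).trans (add_le_add ?_ ?_)
    · calc ‖∑ i ∈ A with i < k, a i • z i‖ ≤ ∑ i ∈ A with i < k, levelThreshold k * M := by
            refine norm_sum_le_of_le _ fun i hi => ?_
            rw [norm_smul]
            exact mul_le_mul (hA1 i (Finset.mem_filter.1 hi).1).2 (hz i) (norm_nonneg _)
              (levelThreshold_pos k).le
        _ = (A.filter (· < k)).card * (levelThreshold k * M) := by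
            rw [Finset.sum_const, nsmul_eq_mul]
        _ ≤ k * (levelThreshold k * M) := by
            refine mul_le_mul_of_nonneg_right ?_ (mul_nonneg (levelThreshold_pos k).le hM)
            have : (A.filter (· < k)).card ≤ (Finset.range k).card :=
              Finset.card_le_card fun i hi => by simpa using (Finset.mem_filter.1 hi).2
            rw [Finset.card_range] at this
            exact_mod_cast this
        _ = M * (k * levelThreshold k) := by ring
        _ ≤ _ := mul_le_mul_of_nonneg_left (natCast_mul_levelThreshold_le k) hM
    · set T := A.filter fun i => ¬ i < k with hT
      have hTk : ∀ i ∈ T, k ≤ i := fun i hi => not_lt.1 (Finset.mem_filter.1 hi).2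
      have hTA : ∀ i ∈ T, i ∈ A := fun i hi => (Finset.mem_filter.1 hi).1
      -- Test the sum bound on a subset of exactly `H k` elements: each coordinate exceeds
      -- `levelThreshold (k + 1)`, which contradicts the choice of `H k`.
      have hcard : T.card ≤ H k := by
        by_contra hcon
        obtain ⟨F, hFT, hF⟩ := Finset.exists_subset_card_eq (not_le.1 hcon).le
        have h1 := haF k F (fun i hi => hTk i (hFT hi)) hF.le
        have h2 : levelThreshold (k + 1) * H k ≤ ∑ i ∈ F, ‖a i‖ := by
          rw [← hF, mul_comm, ← nsmul_eq_mul]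
          exact Finset.card_nsmul_le_sum _ _ _ fun i hi => (hA1 i (hTA i (hFT hi))).1.le
        rw [hF] at h1
        linarith [hH k]
      exact hzF k T hTk hcard (fun i hi => (hA1 i (hTA i hi)).2) fun F' hF' =>
        haF k F' (fun i hi => hTk i (hF' hi)) ((Finset.card_le_card hF').trans hcard)
  have hsummable : Summable fun k => M * (1 / 2 : ℝ) ^ k + G k :=
    ((summable_geometric_of_lt_one (by norm_num) (by norm_num)).mul_left M).add hG
  rw [← Finset.sum_fiberwise_of_maps_to (t := a.support.image lev)
    fun i hi => Finset.mem_image_of_mem lev hi]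
  refine (norm_sum_le_of_le _ fun k _ => hterm k).trans ?_
  exact hsummable.sum_le_tsum _ fun k _ =>
    add_nonneg (mul_nonneg hM (by positivity)) (hG0 k)

end Levels

end

noncomputable section

/-! ### Uniform estimates from the spreading models -/

section Spreading

variable {𝕜 X E : Type*} [RCLike 𝕜] [NormedAddCommGroup X] [NormedSpace 𝕜 X]
  [NormedAddCommGroup E] [NormedSpace 𝕜 E]

theorem norm_sum_smul_sub_le {l : ℕ} (u : Fin l → X) (a b : Fin l → 𝕜) :
    |‖∑ i, a i • u i‖ - ‖∑ i, b i • u i‖| ≤ ‖a - b‖ * ∑ i, ‖u i‖ := by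
  refine (abs_norm_sub_norm_le _ _).trans ?_
  rw [← Finset.sum_sub_distrib, Finset.mul_sum]
  refine norm_sum_le_of_le _ fun i _ => ?_
  rw [← sub_smul, norm_smul]
  exact mul_le_mul_of_nonneg_right (norm_le_pi_norm (a - b) i) (norm_nonneg _)

/-- For fixed length both norms are Lipschitz in the coefficients, uniformly in the indices, so a
finite net of the compact unit ball gives one `N` for all coefficients; homogeneity does the rest.
-/
theorem IsSpreadingModel.exists_uniform {x : ℕ → X} {e : ℕ → E} (h : IsSpreadingModel 𝕜 x e)
    {M : ℝ} (hM : ∀ n, ‖x n‖ ≤ M) (l : ℕ) {ε : ℝ} (hε : 0 < ε) :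
    ∃ N : ℕ, ∀ n : Fin l → ℕ, StrictMono n → (∀ i, N ≤ n i) → ∀ a : Fin l → 𝕜,
      |‖∑ i, a i • x (n i)‖ - ‖∑ i, a i • e i‖| ≤ ε * ‖a‖ := by
  have hM0 : 0 ≤ M := (norm_nonneg _).trans (hM 0)
  set L : ℝ := l * M + ∑ i : Fin l, ‖e i‖ + 1 with hL
  have hse : 0 ≤ ∑ i : Fin l, ‖e i‖ := Finset.sum_nonneg fun _ _ => norm_nonneg _
  have hL0 : 0 < L := by positivity
  obtain ⟨t, -, htf, htc⟩ := finite_cover_balls_of_compact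
    (isCompact_closedBall (0 : Fin l → 𝕜) 1) (show 0 < ε / (2 * L) by positivity)
  choose N hN using fun b : Fin l → 𝕜 => h.2 l b (ε / 2) (by positivity)
  obtain ⟨N₀, hN₀⟩ := (htf.image N).bddAbove
  refine ⟨N₀, fun n hn hnN => ?_⟩
  have hball : ∀ a : Fin l → 𝕜, ‖a‖ ≤ 1 →
      |‖∑ i, a i • x (n i)‖ - ‖∑ i, a i • e i‖| ≤ ε := by
    intro a ha
    have ha' : a ∈ Metric.closedBall (0 : Fin l → 𝕜) 1 := by simpa using ha
    obtain ⟨b, hb, hab⟩ := Set.mem_iUnion₂.1 (htc ha')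
    rw [Metric.mem_ball, dist_eq_norm] at hab
    have h1 := hN b n hn fun i => (hN₀ (Set.mem_image_of_mem N hb)).trans (hnN i)
    have h2 := norm_sum_smul_sub_le (fun i => x (n i)) a b
    have h3 := norm_sum_smul_sub_le (fun i : Fin l => e i) a b
    have h4 : ∑ i, ‖x (n i)‖ ≤ l * M := by
      refine (Finset.sum_le_sum fun i _ => hM (n i)).trans ?_
      simp
    have h5 : ‖a - b‖ * ∑ i, ‖x (n i)‖ + ‖a - b‖ * ∑ i : Fin l, ‖e i‖ ≤ ε / 2 := by
      rw [← mul_add]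
      calc ‖a - b‖ * (∑ i, ‖x (n i)‖ + ∑ i : Fin l, ‖e i‖) ≤ ε / (2 * L) * L := by
            refine mul_le_mul hab.le (by linarith) ?_ (by positivity)
            exact add_nonneg (Finset.sum_nonneg fun _ _ => norm_nonneg _) hse
        _ = ε / 2 := by field_simp
    rw [abs_lt] at h1
    rw [abs_le] at h2 h3 ⊢
    constructor <;> linarith [h1.1, h1.2, h2.1, h2.2, h3.1, h3.2]
  intro a
  rcases eq_or_ne a 0 with rfl | ha
  · simp
  · have hna : 0 < ‖a‖ := norm_pos_iff.2 ha
    have h1 := hball (((‖a‖⁻¹ : ℝ) : 𝕜) • a) (by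
      rw [norm_smul, RCLike.norm_ofReal, abs_of_pos (inv_pos.2 hna), inv_mul_cancel₀ hna.ne'])
    simp only [Pi.smul_apply, smul_assoc, ← Finset.smul_sum] at h1
    rw [norm_smul, norm_smul, RCLike.norm_ofReal, abs_of_pos (inv_pos.2 hna), ← mul_sub, abs_mul,
      abs_of_pos (inv_pos.2 hna), inv_mul_le_iff₀ hna] at h1
    linarith

/-- The finitely supported sequence that begins with a given tuple and is zero afterwards. -/
def finsuppOfTuple {l : ℕ} (b : Fin l → 𝕜) : ℕ →₀ 𝕜 :=
  Finsupp.embDomain Fin.valEmbedding (Finsupp.equivFunOnFinite.symm b)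

theorem finsuppOfTuple_val {l : ℕ} (b : Fin l → 𝕜) (j : Fin l) :
    finsuppOfTuple b (j : ℕ) = b j :=
  Finsupp.embDomain_apply_self Fin.valEmbedding (Finsupp.equivFunOnFinite.symm b) j

theorem finsuppOfTuple_of_le {l : ℕ} (b : Fin l → 𝕜) {i : ℕ} (hi : l ≤ i) :
    finsuppOfTuple b i = 0 :=
  Finsupp.embDomain_of_notMem_range _ _ _ <| by
    rintro ⟨j, rfl⟩
    exact absurd j.2 (not_lt.2 hi)

theorem finsuppOfTuple_sum {l : ℕ} (b : Fin l → 𝕜) (e : ℕ → E) :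
    ((finsuppOfTuple b).sum fun i t => t • e i) = ∑ j, b j • e j := by
  rw [finsuppOfTuple, Finsupp.sum_embDomain, Finsupp.sum_fintype _ _ (by simp)]
  simp

theorem sum_eq_sum_orderEmbOfFin {α : Type*} [AddCommMonoid α] (F : Finset ℕ) {l : ℕ}
    (h : F.card = l) (g : ℕ → α) : ∑ i ∈ F, g i = ∑ j, g (F.orderEmbOfFin h j) := by
  conv_lhs => rw [← Finset.map_orderEmbOfFin_univ F h]
  rw [Finset.sum_map]
  rfl

theorem le_gNorm {g : ℝ → ℝ} (hg : ∀ t, 1 ≤ t → 1 ≤ g t) (a : ℕ →₀ 𝕜) {s : Finset ℕ}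
    (hs : s.Nonempty) : (1 / g (s.card : ℝ)) * ∑ i ∈ s, ‖a i‖ ≤ gNorm g a := by
  classical
  refine le_ciSup (f := fun s : {s : Finset ℕ // s.Nonempty} =>
    (1 / g (s.1.card : ℝ)) * ∑ i ∈ s.1, ‖a i‖) ⟨∑ i ∈ a.support, ‖a i‖, ?_⟩ ⟨s, hs⟩
  rintro _ ⟨⟨T, hT⟩, rfl⟩
  have h1 : (1 : ℝ) ≤ T.card := by exact_mod_cast hT.card_pos
  have h2 : 1 / g (T.card : ℝ) ≤ 1 :=
    (div_le_one (one_pos.trans_le (hg _ h1))).2 (hg _ h1)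
  have h3 : ∑ i ∈ T, ‖a i‖ ≤ ∑ i ∈ a.support, ‖a i‖ := by
    rw [← Finset.sum_filter_add_sum_filter_not T (· ∈ a.support)]
    have : ∑ i ∈ T with i ∉ a.support, ‖a i‖ = 0 :=
      Finset.sum_eq_zero fun i hi => by simpa using (Finset.mem_filter.1 hi).2
    rw [this, add_zero]
    exact Finset.sum_le_sum_of_subset_of_nonneg
      (fun i hi => (Finset.mem_filter.1 hi).2) fun _ _ _ => norm_nonneg _
  have h4 : 0 ≤ ∑ i ∈ T, ‖a i‖ := Finset.sum_nonneg fun _ _ => norm_nonneg _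
  calc (1 / g (T.card : ℝ)) * ∑ i ∈ T, ‖a i‖ ≤ 1 * ∑ i ∈ T, ‖a i‖ :=
        mul_le_mul_of_nonneg_right h2 h4
    _ ≤ _ := by rwa [one_mul]

theorem IsSpreadingModel.exists_sum_norm_le {x : ℕ → X} {e : ℕ → E}
    (h : IsSpreadingModel 𝕜 x e) {M : ℝ} (hM : ∀ n, ‖x n‖ ≤ M) {p c : ℝ} (hp : 0 ≤ p)
    (hc : 0 < c)
    (h_lower : ∀ a : ℕ →₀ 𝕜, c * gNorm (fPow p) a ≤ ‖a.sum fun i t => t • e i‖) (l : ℕ) :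
    ∃ N : ℕ, ∀ F : Finset ℕ, F.card = l → (∀ i ∈ F, N ≤ i) → ∀ a : ℕ → 𝕜,
      ∑ i ∈ F, ‖a i‖ ≤ 2 / c * fPow p l * ‖∑ i ∈ F, a i • x i‖ := by
  rcases Nat.eq_zero_or_pos l with rfl | hl
  · refine ⟨0, fun F hF _ a => ?_⟩
    rw [Finset.card_eq_zero.1 hF]
    simp
  have hl1 : (1 : ℝ) ≤ l := by exact_mod_cast hl
  have hf := fPow_pos p hl1
  -- The tolerance is half of the lower bound `c / f(l)^p`, whence the factor `2 / c`.
  obtain ⟨N, hN⟩ := h.exists_uniform hM l (show 0 < c / (2 * fPow p l) by positivity)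
  refine ⟨N, fun F hF hFN a => ?_⟩
  set n := F.orderEmbOfFin hF
  have h1 := hN n n.strictMono (fun i => hFN _ (F.orderEmbOfFin_mem hF i)) fun j => a (n j)
  have h2 := h_lower (finsuppOfTuple fun j => a (n j))
  rw [finsuppOfTuple_sum] at h2
  have h3 := le_gNorm (fun t ht => one_le_fPow hp ht) (finsuppOfTuple fun j => a (n j))
    (s := Finset.range l) (Finset.nonempty_range_iff.2 hl.ne')
  rw [Finset.card_range, Finset.sum_range] at h3
  simp only [finsuppOfTuple_val] at h3
  rw [sum_eq_sum_orderEmbOfFin F hF, sum_eq_sum_orderEmbOfFin F hF]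
  have h4 : ‖fun j => a (n j)‖ ≤ ∑ j, ‖a (n j)‖ :=
    (pi_norm_le_iff_of_nonneg (Finset.sum_nonneg fun _ _ => norm_nonneg _)).2 fun j =>
      Finset.single_le_sum (f := fun j => ‖a (n j)‖) (fun _ _ => norm_nonneg _)
        (Finset.mem_univ j)
  have h5 := mul_le_mul_of_nonneg_left h3 hc.le
  have h6 := mul_le_mul_of_nonneg_left h4 (show 0 ≤ c / (2 * fPow p l) by positivity)
  rw [abs_le] at h1
  have h7 : c * (1 / fPow p l * ∑ j, ‖a (n j)‖) - c / (2 * fPow p l) * ∑ j, ‖a (n j)‖ ≤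
      ‖∑ j, a (n j) • x (n j)‖ := by linarith [h1.1]
  have h8 : c * (1 / fPow p l * ∑ j, ‖a (n j)‖) - c / (2 * fPow p l) * ∑ j, ‖a (n j)‖ =
      c / (2 * fPow p l) * ∑ j, ‖a (n j)‖ := by
    field_simp
    ring
  rw [h8] at h7
  calc ∑ j, ‖a (n j)‖ = 2 / c * fPow p l * (c / (2 * fPow p l) * ∑ j, ‖a (n j)‖) := by field_simp
    _ ≤ _ := mul_le_mul_of_nonneg_left h7 (by positivity)

/-- `N` depends on the cardinality alone, so finitely many values of `N` serve all sets with at most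
`H k` elements. The term `levelThreshold k` is the approximation error, with tolerance `1`. -/
theorem IsSpreadingModel.exists_norm_sum_le {y : ℕ → X} {e : ℕ → E}
    (h : IsSpreadingModel 𝕜 y e) {M : ℝ} (hM : ∀ n, ‖y n‖ ≤ M) {p q C K : ℝ} (hp : 0 < p)
    (hpq : p < q) (hC : 0 < C) (hK : 0 ≤ K)
    (h_upper : ∀ a : ℕ →₀ 𝕜, ‖a.sum fun i t => t • e i‖ ≤ C * gLorentzNorm (fPow q) a) (l : ℕ) :
    ∃ N : ℕ, ∀ (F : Finset ℕ) (m : ℕ → ℕ), F.card = l → StrictMono m → (∀ i ∈ F, N ≤ m i) →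
      ∀ (a : ℕ → 𝕜) (k : ℕ), (∀ i ∈ F, ‖a i‖ ≤ levelThreshold k) →
        (∀ F' ⊆ F, ∑ i ∈ F', ‖a i‖ ≤ K * fPow p F'.card) →
        ‖∑ i ∈ F, a i • y (m i)‖ ≤ C * levelBound p q K k + levelThreshold k := by
  classical
  obtain ⟨N, hN⟩ := h.exists_uniform hM l one_pos
  refine ⟨N, fun F m hF hm hFN a k hak haF => ?_⟩
  set n := F.orderEmbOfFin hF with hn
  have hnF : ∀ j, n j ∈ F := F.orderEmbOfFin_mem hF
  have h1 := hN (fun j => m (n j)) (hm.comp n.strictMono) (fun i => hFN _ (hnF i))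
    fun j => a (n j)
  have h2 := h_upper (finsuppOfTuple fun j => a (n j))
  rw [finsuppOfTuple_sum] at h2
  have h3 : gLorentzNorm (fPow q) (finsuppOfTuple fun j => a (n j)) ≤ levelBound p q K k := by
    refine gLorentzNorm_le_levelBound hp hpq hK _ (fun S => ?_) k fun i => ?_
    · let J : Finset (Fin l) := Finset.univ.filter fun j => (j : ℕ) ∈ S
      have e1 : ∑ i ∈ S, ‖finsuppOfTuple (fun j => a (n j)) i‖ = ∑ j ∈ J, ‖a (n j)‖ := by
        symm
        refine Finset.sum_bij_ne_zero (fun j _ _ => (j : ℕ)) (fun j hj _ => ?_)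
          (fun j _ _ j' _ _ hjj => Fin.ext hjj) (fun i hi hi0 => ?_) fun j _ _ => ?_
        · exact (Finset.mem_filter.1 hj).2
        · have hil : i < l := by
            by_contra hcon
            exact hi0 (by rw [finsuppOfTuple_of_le _ (not_lt.1 hcon), norm_zero])
          refine ⟨⟨i, hil⟩, Finset.mem_filter.2 ⟨Finset.mem_univ _, hi⟩, ?_, rfl⟩
          rwa [← finsuppOfTuple_val fun j => a (n j)]
        · rw [finsuppOfTuple_val]
      have e2 : ∑ j ∈ J, ‖a (n j)‖ = ∑ i ∈ J.map n.toEmbedding, ‖a i‖ := by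
        rw [Finset.sum_map]
        rfl
      have e3 : J.card ≤ S.card :=
        Finset.card_le_card_of_injOn (fun j => (j : ℕ))
          (fun j hj => (Finset.mem_filter.1 hj).2) (Fin.val_injective.injOn)
      rw [e1, e2]
      refine (haF _ fun i hi => ?_).trans (mul_le_mul_of_nonneg_left ?_ hK)
      · obtain ⟨j, -, rfl⟩ := Finset.mem_map.1 hi
        exact hnF j
      · rw [Finset.card_map]
        exact fPow_mono hp.le (Nat.cast_nonneg _) (Nat.cast_le.2 e3)
    · rcases lt_or_ge i l with hi | hi
      · have := finsuppOfTuple_val (fun j => a (n j)) ⟨i, hi⟩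
        simp only at this
        rw [this]
        exact hak _ (hnF _)
      · rw [finsuppOfTuple_of_le _ hi, norm_zero]
        exact (levelThreshold_pos k).le
  have h4 : ‖fun j => a (n j)‖ ≤ levelThreshold k :=
    (pi_norm_le_iff_of_nonneg (levelThreshold_pos k).le).2 fun j => hak _ (hnF j)
  rw [sum_eq_sum_orderEmbOfFin F hF]
  have h5 := mul_le_mul_of_nonneg_left h3 hC.le
  linarith [(abs_le.1 h1).2]

end Spreading

end

/-! ### Control of coordinate sums along a subsequence -/

section Domination

variable {𝕜 X E : Type*} [RCLike 𝕜] [NormedAddCommGroup X] [NormedSpace 𝕜 X]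
  [NormedAddCommGroup E] [NormedSpace 𝕜 E]

theorem sum_abs_le_two_mul (g : 𝕜 →+ ℝ) (hg : ∀ z, |g z| ≤ ‖z‖) {ι : Type*} (F : Finset ι)
    (z : ι → 𝕜) {T : ℝ} (h : ∀ S ⊆ F, ‖∑ i ∈ S, z i‖ ≤ T) : ∑ i ∈ F, |g (z i)| ≤ 2 * T := by
  classical
  have key : ∀ S ⊆ F, |∑ i ∈ S, g (z i)| ≤ T := fun S hS => by
    rw [← map_sum]
    exact (hg _).trans (h S hS)
  rw [← Finset.sum_filter_add_sum_filter_not F fun i => 0 ≤ g (z i)]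
  have h1 : ∑ i ∈ F with 0 ≤ g (z i), |g (z i)| = ∑ i ∈ F with 0 ≤ g (z i), g (z i) :=
    Finset.sum_congr rfl fun i hi => abs_of_nonneg (Finset.mem_filter.1 hi).2
  have h2 : ∑ i ∈ F with ¬ 0 ≤ g (z i), |g (z i)| = -∑ i ∈ F with ¬ 0 ≤ g (z i), g (z i) := by
    rw [← Finset.sum_neg_distrib]
    exact Finset.sum_congr rfl fun i hi => abs_of_neg (not_le.1 (Finset.mem_filter.1 hi).2)
  rw [h1, h2]
  have h3 := abs_le.1 (key _ (Finset.filter_subset (fun i => 0 ≤ g (z i)) F))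
  have h4 := abs_le.1 (key _ (Finset.filter_subset (fun i => ¬ 0 ≤ g (z i)) F))
  linarith [h3.2, h4.1]

/-- Split into real and imaginary parts and each of these by sign; on each of the four subsets no
cancellation occurs. -/
theorem sum_norm_le_four_mul {ι : Type*} (F : Finset ι) (z : ι → 𝕜) {T : ℝ}
    (h : ∀ S ⊆ F, ‖∑ i ∈ S, z i‖ ≤ T) : ∑ i ∈ F, ‖z i‖ ≤ 4 * T := by
  have h1 := sum_abs_le_two_mul RCLike.re RCLike.abs_re_le_norm F z h
  have h2 := sum_abs_le_two_mul RCLike.im RCLike.abs_im_le_norm F z h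
  have h3 : ∑ i ∈ F, ‖z i‖ ≤ ∑ i ∈ F, (|RCLike.re (z i)| + |RCLike.im (z i)|) :=
    Finset.sum_le_sum fun i _ => by
      have hd : ‖((RCLike.re (z i) : ℝ) : 𝕜) + (RCLike.im (z i) : ℝ) * RCLike.I‖ ≤
          |RCLike.re (z i)| + |RCLike.im (z i)| := by
        refine (norm_add_le _ _).trans (add_le_add (RCLike.norm_ofReal _).le ?_)
        rw [norm_mul, RCLike.norm_ofReal]
        exact mul_le_of_le_one_right (abs_nonneg _) (by rw [RCLike.norm_I]; split_ifs <;> simp)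
      rwa [RCLike.re_add_im] at hd
  rw [Finset.sum_add_distrib] at h3
  linarith

/-- Extends the functional `∑ aᵢ xᵢ ↦ ∑ aᵢ`. -/
theorem exists_strongDual_eq_one_on (x : ℕ → X) (F : Finset ℕ) {R : ℝ} (hR : 0 ≤ R)
    (h : ∀ a : ℕ → 𝕜, ∑ i ∈ F, ‖a i‖ ≤ R * ‖∑ i ∈ F, a i • x i‖) :
    ∃ φ : StrongDual 𝕜 X, ‖φ‖ ≤ R ∧ ∀ i ∈ F, φ (x i) = 1 := by
  classical
  let e : (ℕ → 𝕜) →ₗ[𝕜] X := ∑ i ∈ F, (LinearMap.proj i : (ℕ → 𝕜) →ₗ[𝕜] 𝕜).smulRight (x i)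
  let f : (ℕ → 𝕜) →ₗ[𝕜] 𝕜 := ∑ i ∈ F, (LinearMap.proj i : (ℕ → 𝕜) →ₗ[𝕜] 𝕜)
  have he : ∀ a, e a = ∑ i ∈ F, a i • x i := fun a => by simp [e]
  have hf : ∀ a, f a = ∑ i ∈ F, a i := fun a => by simp [f]
  obtain ⟨φ, hφ, hφe⟩ := exists_strongDual_comp_eq f e hR fun a => by
    rw [he, hf]
    exact (norm_sum_le _ _).trans (h a)
  refine ⟨φ, hφ, fun i hi => ?_⟩
  have := hφe (Pi.single i 1)
  rw [he, hf] at this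
  simpa [Pi.single_apply, ite_smul, hi] using this

/-- A substitute for unconditionality. `K` and `D` precede `H` and `N`, since the caller chooses `H`
in terms of `K` and `D`. -/
theorem exists_subsequence_sum_norm_le [CompleteSpace X] {x : ℕ → X} {e : ℕ → E}
    (hx_basic : IsBasicSequence 𝕜 x) (hx_semi : IsSeminormalized x) (hx_null : IsWeaklyNull 𝕜 x)
    (hE : IsSpreadingModel 𝕜 x e) {p c : ℝ} (hp : 0 < p) (hc : 0 < c)
    (h_lower : ∀ a : ℕ →₀ 𝕜, c * gNorm (fPow p) a ≤ ‖a.sum fun i t => t • e i‖) :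
    ∃ K D : ℝ, 0 ≤ K ∧ 0 < D ∧ ∀ (H : ℕ → ℕ) (N : ℕ → ℕ), Monotone H →
      ∃ m : ℕ → ℕ, StrictMono m ∧ (∀ k, N k ≤ m k) ∧ ∀ a : ℕ →₀ 𝕜,
        (∀ i, ‖a i‖ ≤ D * ‖Finsupp.linearCombination 𝕜 (x ∘ m) a‖) ∧
        ∀ (k : ℕ) (F : Finset ℕ), (∀ i ∈ F, k ≤ i) → F.card ≤ H k →
          ∑ i ∈ F, ‖a i‖ ≤
            K * ‖Finsupp.linearCombination 𝕜 (x ∘ m) a‖ * fPow p F.card := by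
  classical
  obtain ⟨B, hB0, hB⟩ := hx_basic.exists_norm_filter_le
  obtain ⟨D, hD0, hD⟩ := hx_basic.exists_norm_apply_le hx_semi
  obtain ⟨m₀, M, hm₀, hM⟩ := hx_semi
  choose L hL using hE.exists_sum_norm_le (fun n => (hM n).2) hp.le hc h_lower
  have hR0 : ∀ l : ℕ, 0 ≤ 2 / c * fPow p l := fun l =>
    mul_nonneg (by positivity) (fPow_nonneg _ (Nat.cast_nonneg _))
  -- Sets that start too early get the zero functional, so that `Φ` is total and its norm bound
  -- holds everywhere.
  have hΦ : ∀ F : Finset ℕ, ∃ φ : StrongDual 𝕜 X, ‖φ‖ ≤ 2 / c * fPow p F.card ∧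
      ((∀ i ∈ F, L F.card ≤ i) → ∀ i ∈ F, φ (x i) = 1) := by
    intro F
    by_cases hF : ∀ i ∈ F, L F.card ≤ i
    · obtain ⟨φ, h1, h2⟩ := exists_strongDual_eq_one_on x F (hR0 F.card) (hL _ F rfl hF)
      exact ⟨φ, h1, fun _ => h2⟩
    · exact ⟨0, by simpa using hR0 F.card, fun h => absurd h hF⟩
  choose Φ hΦ1 hΦ2 using hΦ
  -- `2/c · (1 + B)` comes from `Φ S` on a tail of `v`, `4D` from its values off `S`, and the outer
  -- `4` from passing from `|∑ aᵢ|` to `∑ |aᵢ|`.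
  refine ⟨4 * (2 / c * (1 + B) + 4 * D), D, by positivity, hD0, fun H N hH => ?_⟩
  obtain ⟨m, hm, hmN, hsmall⟩ := exists_subsequence_small_off_support x hx_null Φ
    (fun l => 2 / c * fPow p l) hΦ1 H hH
    fun k => max (N k) ((Finset.range (H k + 1)).sup L)
  refine ⟨m, hm, fun k => (le_max_left _ _).trans (hmN k), fun a => ?_⟩
  set v := Finsupp.linearCombination 𝕜 (x ∘ m) a with hv
  have hva : v = Finsupp.linearCombination 𝕜 x (a.mapDomain m) := by
    rw [hv, Finsupp.linearCombination_mapDomain]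
  have hcoord : ∀ i, ‖a i‖ ≤ D * ‖v‖ := fun i => by
    have := hD (a.mapDomain m) (m i)
    rwa [Finsupp.mapDomain_apply hm.injective, ← hva] at this
  refine ⟨hcoord, fun k F hFk hFH => ?_⟩
  rcases F.eq_empty_or_nonempty with rfl | hne
  · simp only [Finset.sum_empty]
    exact mul_nonneg (by positivity) (fPow_nonneg _ (Nat.cast_nonneg _))
  have hF1 : (1 : ℝ) ≤ F.card := by exact_mod_cast hne.card_pos
  have hfF := one_le_fPow hp.le hF1
  -- The coordinates below `k` are removed because the functionals are small only at terms of index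
  -- at least `k`.
  have tail : ‖v - Finsupp.linearCombination 𝕜 (x ∘ m) (a.filter (· < k))‖ ≤ (1 + B) * ‖v‖ := by
    have := hB (a.mapDomain m) (m k)
    rw [linearCombination_mapDomain_filter_lt x hm, ← hva] at this
    refine (norm_sub_le _ _).trans ?_
    linarith
  have hw : v - Finsupp.linearCombination 𝕜 (x ∘ m) (a.filter (· < k)) =
      ∑ i ∈ a.support with k ≤ i, a i • x (m i) := by
    have h1 := Finsupp.filter_add_filter_not a (· < k)
    have h2 : v = Finsupp.linearCombination 𝕜 (x ∘ m) (a.filter (· < k)) +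
        Finsupp.linearCombination 𝕜 (x ∘ m) (a.filter fun i => ¬ i < k) := by
      rw [← map_add, h1]
    rw [h2, add_sub_cancel_left, Finsupp.linearCombination_apply, Finsupp.sum,
      Finsupp.support_filter]
    simp only [not_lt]
    refine Finset.sum_congr rfl fun i hi => ?_
    rw [Finsupp.filter_apply_pos _ _ (Finset.mem_filter.1 hi).2]
    rfl
  have subset_bound : ∀ S ⊆ F, ‖∑ i ∈ S, a i‖ ≤
      (2 / c * (1 + B) + 4 * D) * ‖v‖ * fPow p F.card := by
    intro S hS
    have hSk : ∀ i ∈ S, k ≤ i := fun i hi => hFk i (hS hi)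
    have hSH : S.card ≤ H k := (Finset.card_le_card hS).trans hFH
    have hcard : (S.image m).card = S.card := Finset.card_image_of_injective _ hm.injective
    have hone : ∀ i ∈ S, Φ (S.image m) (x (m i)) = 1 := by
      intro i hi
      refine hΦ2 (S.image m) (fun n hn => ?_) _ (Finset.mem_image_of_mem m hi)
      obtain ⟨j, hj, rfl⟩ := Finset.mem_image.1 hn
      rw [hcard]
      calc L S.card ≤ (Finset.range (H k + 1)).sup L :=
            Finset.le_sup (f := L) (Finset.mem_range.2 (Nat.lt_succ_of_le hSH))
        _ ≤ m k := (le_max_right _ _).trans (hmN k)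
        _ ≤ m j := hm.monotone (hSk j hj)
    have hsum : Φ (S.image m) (∑ i ∈ a.support with k ≤ i, a i • x (m i)) =
        ∑ i ∈ S, a i +
          ∑ i ∈ a.support with k ≤ i ∧ i ∉ S, a i * Φ (S.image m) (x (m i)) := by
      rw [map_sum, ← Finset.sum_filter_add_sum_filter_not (a.support.filter (k ≤ ·)) (· ∈ S),
        Finset.filter_filter, Finset.filter_filter]
      congr 1
      · rw [← Finset.sum_subset (s₁ := a.support.filter fun i => k ≤ i ∧ i ∈ S) (s₂ := S)
          (fun i hi => (Finset.mem_filter.1 hi).2.2)]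
        · refine Finset.sum_congr rfl fun i hi => ?_
          rw [map_smul, hone i (Finset.mem_filter.1 hi).2.2, smul_eq_mul, mul_one]
        · intro i hi hni
          by_contra h0
          exact hni (Finset.mem_filter.2 ⟨Finsupp.mem_support_iff.2 h0, hSk i hi, hi⟩)
      · exact Finset.sum_congr rfl fun i _ => by rw [map_smul, smul_eq_mul]
    have hrest : ‖∑ i ∈ a.support with k ≤ i ∧ i ∉ S, a i * Φ (S.image m) (x (m i))‖ ≤
        4 * D * ‖v‖ := by
      have hgeo : Summable fun i : ℕ => (1 / 2 : ℝ) ^ i :=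
        summable_geometric_of_lt_one (by norm_num) (by norm_num)
      calc _ ≤ ∑ i ∈ a.support with k ≤ i ∧ i ∉ S, D * ‖v‖ * (2 * (1 / 2) ^ i) := by
            refine norm_sum_le_of_le _ fun i hi => ?_
            obtain ⟨-, h1, h2⟩ := Finset.mem_filter.1 hi
            rw [norm_mul]
            exact mul_le_mul (hcoord i) (hsmall k S hSk hSH i h1 h2) (norm_nonneg _)
              (by positivity)
        _ = D * ‖v‖ * 2 * ∑ i ∈ a.support with k ≤ i ∧ i ∉ S, (1 / 2 : ℝ) ^ i := by
            rw [Finset.mul_sum]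
            exact Finset.sum_congr rfl fun i _ => by ring
        _ ≤ D * ‖v‖ * 2 * 2 := by
            refine mul_le_mul_of_nonneg_left ?_ (by positivity)
            exact (hgeo.sum_le_tsum _ fun i _ => by positivity).trans tsum_geometric_two.le
        _ = _ := by ring
    have hSF : fPow p S.card ≤ fPow p F.card :=
      fPow_mono hp.le (Nat.cast_nonneg _) (Nat.cast_le.2 (Finset.card_le_card hS))
    have hmain : ‖Φ (S.image m) (∑ i ∈ a.support with k ≤ i, a i • x (m i))‖ ≤
        2 / c * fPow p F.card * ((1 + B) * ‖v‖) := by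
      refine (ContinuousLinearMap.le_opNorm _ _).trans ?_
      refine mul_le_mul ((hΦ1 _).trans ?_) (hw ▸ tail) (norm_nonneg _) (hR0 _)
      rw [hcard]
      exact mul_le_mul_of_nonneg_left hSF (by positivity)
    have h4 : ‖∑ i ∈ S, a i‖ ≤ 2 / c * fPow p F.card * ((1 + B) * ‖v‖) + 4 * D * ‖v‖ := by
      rw [eq_sub_of_add_eq hsum.symm]
      exact (norm_sub_le _ _).trans (add_le_add hmain hrest)
    have h5 : 4 * D * ‖v‖ ≤ 4 * D * ‖v‖ * fPow p F.card :=
      le_mul_of_one_le_right (by positivity) hfF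
    calc _ ≤ _ := h4
      _ ≤ 2 / c * fPow p F.card * ((1 + B) * ‖v‖) + 4 * D * ‖v‖ * fPow p F.card := by linarith
      _ = _ := by ring
  refine (sum_norm_le_four_mul F a subset_bound).trans (le_of_eq ?_)
  ring

end Domination

/-! ### The domination theorem -/

theorem lemma1p8 {𝕜 X E F : Type*} [RCLike 𝕜]
    [NormedAddCommGroup X] [NormedSpace 𝕜 X] [CompleteSpace X]
    [NormedAddCommGroup E] [NormedSpace 𝕜 E] [CompleteSpace E]
    [NormedAddCommGroup F] [NormedSpace 𝕜 F] [CompleteSpace F]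
    (x y : ℕ → X)
    (hx_basic : IsBasicSequence 𝕜 x) (hx_semi : IsSeminormalized x) (hx_null : IsWeaklyNull 𝕜 x)
    (hy_basic : IsBasicSequence 𝕜 y) (hy_semi : IsSeminormalized y) (hy_null : IsWeaklyNull 𝕜 y)
    (x' : ℕ → E) (y' : ℕ → F)
    (hE : IsSpreadingModel 𝕜 x x') (hF : IsSpreadingModel 𝕜 y y')
    (p q c C : ℝ) (hp : 0 < p) (hpq : p < q) (hc : 0 < c) (hC : 0 < C)
    (h_lower : ∀ a : ℕ →₀ 𝕜, c * gNorm (fPow p) a ≤ ‖a.sum fun i t => t • x' i‖)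
    (h_upper : ∀ a : ℕ →₀ 𝕜, ‖a.sum fun i t => t • y' i‖ ≤ C * gLorentzNorm (fPow q) a) :
    ∃ n : ℕ → ℕ, StrictMono n ∧
      ∃ T : closedSpan 𝕜 (fun k => x (n k)) →L[𝕜] closedSpan 𝕜 (fun k => y (n k)),
        ∀ k, T ⟨x (n k), mem_closedSpan 𝕜 (fun k => x (n k)) k⟩ =
          ⟨y (n k), mem_closedSpan 𝕜 (fun k => y (n k)) k⟩ := by
  classical
  obtain ⟨K, D, hK, hD, hsub⟩ :=
    exists_subsequence_sum_norm_le hx_basic hx_semi hx_null hE hp hc h_lower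
  obtain ⟨m₀, M, hm₀, hM⟩ := hy_semi
  have hM0 : 0 ≤ M := (norm_nonneg _).trans (hM 0).2
  set K' : ℝ := K / (4 * D) with hK'
  have hK'0 : 0 ≤ K' := by positivity
  -- `H k` is where linear growth with slope `levelThreshold (k + 1)` has overtaken `K' f^p`.
  obtain ⟨H, hHmono, hH⟩ := extraction_forall_of_eventually fun k =>
    eventually_mul_fPow_lt p (levelThreshold_pos (k + 1)) K'
  choose N hN using hF.exists_norm_sum_le (fun n => (hM n).2) hp hpq hC hK'0 h_upper
  obtain ⟨m, hm, hmN, hma⟩ := hsub H (fun k => (Finset.range (H k + 1)).sup N) hHmono.monotone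
  refine ⟨m, hm, exists_clm_closedSpan (𝕜 := 𝕜) (fun k => x (m k)) (fun k => y (m k))
    ((∑' k, (M * (1 / 2) ^ k + (C * levelBound p q K' k + levelThreshold k))) * (4 * D))
    fun a => ?_⟩
  change _ ≤ _ * ‖Finsupp.linearCombination 𝕜 (x ∘ m) a‖
  set v := Finsupp.linearCombination 𝕜 (x ∘ m) a with hv
  rcases eq_or_ne v 0 with hv0 | hv0
  · have ha : a = 0 := by
      ext i
      simpa [← hv, hv0] using (hma a).1 i
    simp [ha, hv0]
  have hvpos : 0 < ‖v‖ := norm_pos_iff.2 hv0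
  -- This scaling makes all coordinates at most `1/4 = levelThreshold 0` and turns `K ‖v‖` into `K'
  -- = K / (4D)`.
  set t : ℝ := (4 * D * ‖v‖)⁻¹ with ht
  have ht0 : 0 < t := by positivity
  have htv : 4 * D * (t * ‖v‖) = 1 := by
    rw [ht]
    field_simp
  have hnorm : ∀ i, ‖((t : 𝕜) • a) i‖ = t * ‖a i‖ := fun i => by
    rw [Finsupp.smul_apply, norm_smul, RCLike.norm_ofReal, abs_of_pos ht0]
  have hbound : ∀ (k : ℕ) (F : Finset ℕ), (∀ i ∈ F, k ≤ i) → F.card ≤ H k →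
      ∑ i ∈ F, ‖((t : 𝕜) • a) i‖ ≤ K' * fPow p F.card := by
    intro k F hFk hFH
    simp only [hnorm]
    rw [← Finset.mul_sum]
    have h1 := mul_le_mul_of_nonneg_left ((hma a).2 k F hFk hFH) ht0.le
    have h2 : K' = K * (t * ‖v‖) := by
      rw [hK', div_eq_iff (by positivity), mul_assoc, mul_comm (t * ‖v‖), htv, mul_one]
    rw [h2]
    calc _ ≤ _ := h1
      _ = _ := by ring
  have hmain := norm_sum_smul_le_of_levels (p := p) (K := K') hM0 H hH
    (fun k => C * levelBound p q K' k + levelThreshold k)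
    (fun k => by
      have h1 := levelThreshold_pos k
      have h2 : 0 ≤ levelBound p q K' k := by
        have h3 : 0 < p + (q - p) / 2 - p := by linarith
        have h4 : 0 < p + (q - p) / 2 := by linarith
        unfold levelBound
        positivity
      positivity)
    (((summable_levelBound hpq K').mul_left C).add
      (Summable.of_nonneg_of_le (fun k => (levelThreshold_pos k).le) levelThreshold_le
        (summable_geometric_of_lt_one (by norm_num) (by norm_num))))
    (fun k => y (m k)) (fun k => (hM (m k)).2) ((t : 𝕜) • a)
    (fun i => by
      rw [hnorm]
      have h1 := mul_le_mul_of_nonneg_left ((hma a).1 i) ht0.le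
      rw [← hv] at h1
      linarith)
    hbound
    (fun k F hFk hFH h1 h2 =>
      hN F.card F m rfl hm (fun i hi => by
        calc N F.card ≤ (Finset.range (H k + 1)).sup N :=
              Finset.le_sup (f := N) (Finset.mem_range.2 (Nat.lt_succ_of_le hFH))
          _ ≤ m k := hmN k
          _ ≤ m i := hm.monotone (hFk i hi)) _ k h1 h2)
  have hlin : ∑ i ∈ ((t : 𝕜) • a).support, ((t : 𝕜) • a) i • y (m i) =
      (t : 𝕜) • Finsupp.linearCombination 𝕜 (fun k => y (m k)) a := by
    rw [← map_smul]
    rfl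
  rw [hlin, norm_smul, RCLike.norm_ofReal, abs_of_pos ht0] at hmain
  calc ‖Finsupp.linearCombination 𝕜 (fun k => y (m k)) a‖ =
        4 * D * ‖v‖ * (t * ‖Finsupp.linearCombination 𝕜 (fun k => y (m k)) a‖) := by
        rw [← mul_assoc, mul_assoc (4 * D), mul_comm ‖v‖, htv, one_mul]
    _ ≤ 4 * D * ‖v‖ *
        ∑' k, (M * (1 / 2) ^ k + (C * levelBound p q K' k + levelThreshold k)) :=
        mul_le_mul_of_nonneg_left hmain (by positivity)
    _ = _ := by ring
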